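/- Let $(X,d)$ be a metric space, let $\mu$ be a Borel probability measure on $X$, and let $T\colon X\to X$ be a Borel measurable map that preserves $\mu$ and is ergodic with respect to $\mu$. Let $\alpha>0$, and let $H_\alpha$ be the $\alpha$-dimensional Hausdorff measure on $X$, normalised by $$H_\alpha(A)=\lim_{\delta\to0}\inf\Big\{\sum_{i}(\operatorname{diam}U_i)^\alpha : A\subset\bigcup_{i} U_i \text{ a countable cover},\ \operatorname{diam}U_i\le\delta\Big\}.$$ For $x\in X$ such that every ball $B(x,r)$, $r>0$, has positive $\mu$-measure, put $$g(x)=\limsup_{r\to0}\frac{H_\alpha(B(x,r))}{\mu(B(x,r))}\in[0,\infty].$$ Then for $\mu$-almost every $x\in X$ at which $g$ is so defined, $$\liminf_{n\to\infty} n^{1/\alpha}\, d(T^n(x),x)\le g(x)^{1/\alpha},$$ where the values $g(x)=0$ and $g(x)=\infty$ are allowed (with $0^{1/\alpha}=0$ and $\infty^{1/\alpha}=\infty$). In particular, if $X$ is separable, then $g$ is defined $\mu$-almost everywhere and the inequality holds for $\mu$-almost every $x\in X$. -/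

import Mathlib

open MeasureTheory Filter Topology
open scoped ENNReal

/-- The function `g(x) = limsup_{r → 0⁺} H_α(B(x,r)) / μ(B(x,r))`, with values in `[0, ∞]`, where
`H_α = μH[α]` is the `α`-dimensional Hausdorff measure (normalised by `(diam U)^α`). -/
noncomputable def hausdorffRatio {X : Type*} [MetricSpace X] [MeasurableSpace X] [BorelSpace X]
    (μ : Measure X) (α : ℝ) (x : X) : ℝ≥0∞ :=
  limsup (fun r : ℝ => μH[α] (Metric.ball x r) / μ (Metric.ball x r)) (𝓝[>] (0 : ℝ))

/-- The lower limit `liminf_{n → ∞} n^{1/α} d(T^n x, x)`, with values in `[0, ∞]`. -/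
noncomputable def recurrenceLiminf {X : Type*} [MetricSpace X]
    (T : X → X) (α : ℝ) (x : X) : ℝ≥0∞ :=
  liminf (fun n : ℕ => ENNReal.ofReal ((n : ℝ) ^ (1 / α) * dist (T^[n] x) x)) atTop

section

open Set Metric
open scoped NNReal

/-! ### Hausdorff measure: mass distribution, densities and a Vitali covering argument. -/

section Hausdorff

variable {X : Type*} [MetricSpace X] [MeasurableSpace X] [BorelSpace X]

/-! If the bound fails on a non-null set, then for some `a < b = q ^ α` and a fixed scale there is a
non-null `E` such that small balls `B` centred in `E` satisfy `μH[α] B ≤ a * μ B`, while close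
returns of points of `E` satisfy `d(T^n x, x) > q n^(-1/α)`. A small set `F` of such points cannot
meet itself again before time about `b / (diam F)^α`; its preimages up to then are disjoint, so `b *
μ F ≤ (diam F)^α` (`rpow_mul_measure_le_ediam_rpow`), and `b • μ.restrict E ≤ μH[α]` follows.

The two bounds clash (`measure_eq_zero_of_hausdorffMeasure_closedBall_le`) once almost all of `E` is
covered by disjoint small balls inside an open set of nearly the same measure. Vitali's theorem
needs doubling, which the diameter bound supplies at points of positive upper density. Points of
zero density are negligible: there every multiple of `μ` is dominated by the locally finite `μH[α]`.
Separability comes for free near `E`, since finite Hausdorff measure forces it. -/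

/-- A set of finite Hausdorff measure is separable. -/
theorem isSeparable_of_hausdorffMeasure_ne_top {α : ℝ} {s : Set X} (h : μH[α] s ≠ ∞) :
    TopologicalSpace.IsSeparable s := by
  obtain ⟨t, -, htc, hst⟩ := EMetric.subset_countable_closure_of_almost_dense_set s fun ε hε => by
    rw [Measure.hausdorffMeasure_apply] at h
    have h' := (lt_of_le_of_lt (le_iSup₂ (f := fun (r : ℝ≥0∞) (_ : 0 < r) =>
      ⨅ (t : ℕ → Set X) (_ : s ⊆ ⋃ n, t n) (_ : ∀ n, ediam (t n) ≤ r),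
          ∑' n, ⨆ _ : (t n).Nonempty, ediam (t n) ^ α) ε hε) h.lt_top)
    simp only [iInf_lt_iff] at h'
    obtain ⟨t, hst, htd, -⟩ := h'
    classical
    let c : ℕ → Set X := fun n => if h : (t n).Nonempty then {h.some} else ∅
    refine ⟨⋃ n, c n, countable_iUnion fun n => ?_, fun x hx => ?_⟩
    · by_cases h : (t n).Nonempty <;> simp [c, h]
    · obtain ⟨n, hn⟩ := mem_iUnion.1 (hst hx)
      have hne : (t n).Nonempty := ⟨x, hn⟩
      refine mem_biUnion (x := hne.some) (mem_iUnion.2 ⟨n, by simp [c, hne]⟩) ?_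
      exact (edist_le_ediam_of_mem hn hne.some_mem).trans (htd n)
  exact ⟨t, htc, hst⟩

/-- If all traces `s ∩ Z` on sets `s` of small diameter have measure at most `(diam s)^α / c`, then
`c • ν.restrict Z` is dominated by the Hausdorff measure. -/
theorem smul_restrict_le_hausdorffMeasure {α : ℝ} {ν : Measure X} {Z : Set X} {c : ℝ≥0} {δ : ℝ≥0∞}
    (hδ : 0 < δ) (h : ∀ s : Set X, ediam s ≤ δ → c * ν (s ∩ Z) ≤ ediam s ^ α) :
    c • ν.restrict Z ≤ μH[α] := by
  refine Measure.le_hausdorffMeasure α _ δ hδ fun s hs => ?_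
  -- `Z` and `s` may be non-measurable; the closure is measurable and has the same diameter.
  calc (c • ν.restrict Z) s ≤ (c • ν.restrict Z) (closure s) := measure_mono subset_closure
    _ = c * ν (closure s ∩ Z) := by
      rw [Measure.smul_apply, Measure.restrict_apply isClosed_closure.measurableSet]; rfl
    _ ≤ ediam (closure s) ^ α := h _ (by rwa [ediam_closure])
    _ = ediam s ^ α := by rw [ediam_closure]

/-- A set of points at which the `α`-dimensional density of `ν.restrict E` vanishes is `ν`-null, if
the Hausdorff measure is locally finite there. -/
theorem measure_eq_zero_of_density_eq_zero [SecondCountableTopology X] {α : ℝ}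
    {ν : Measure X} {E Z : Set X} (hZE : Z ⊆ E)
    (hdens : ∀ x ∈ Z, ∀ c : ℕ, ∀ᶠ r in 𝓝[>] (0 : ℝ),
      c * ν (closedBall x r ∩ E) ≤ ENNReal.ofReal r ^ α)
    (hfin : ∀ x ∈ Z, ∃ r > 0, μH[α] (closedBall x r) ≠ ∞) : ν Z = 0 := by
  let S : ℕ → ℕ → Set X := fun c j =>
    {x ∈ Z | ∀ r, 0 < r → r < 1 / ((j : ℝ) + 1) → c * ν (closedBall x r ∩ E) ≤ ENNReal.ofReal r ^ α}
  have hSmono (c : ℕ) : Monotone (S c) := fun i j hij x hx =>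
    ⟨hx.1, fun r h0 hr => hx.2 r h0 (hr.trans_le (by gcongr))⟩
  have hSU (c : ℕ) : Z ⊆ ⋃ j, S c j := fun x hx => by
    obtain ⟨ε, hε, h⟩ := (nhdsGT_basis (0 : ℝ)).eventually_iff.1 (hdens x hx c)
    obtain ⟨j, hj⟩ := exists_nat_one_div_lt hε
    exact mem_iUnion.2 ⟨j, hx, fun r h0 hr => h ⟨h0, hr.trans hj⟩⟩
  have hS (c j : ℕ) : (c : ℝ≥0) • ν.restrict (S c j) ≤ μH[α] := by
    have hj : (0 : ℝ) < 1 / ((j : ℝ) + 1) := by positivity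
    refine smul_restrict_le_hausdorffMeasure (δ := ENNReal.ofReal (1 / ((j : ℝ) + 1) / 2))
      (by simpa using by positivity) fun s hs => ?_
    rcases (s ∩ S c j).eq_empty_or_nonempty with h | ⟨x, hxs, hx⟩
    · simp [h]
    have hfin : ediam s ≠ ∞ := ne_top_of_le_ne_top ENNReal.ofReal_ne_top hs
    have hdj : diam s < 1 / ((j : ℝ) + 1) := by
      have := ENNReal.toReal_le_of_le_ofReal (by positivity) hs
      exact lt_of_le_of_lt this (by linarith)
    -- Radii slightly above `diam s`, because `diam s` may be `0`.
    have key : ∀ᶠ r in 𝓝[>] (diam s), (c : ℝ≥0) * ν (s ∩ S c j) ≤ ENNReal.ofReal r ^ α := by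
      filter_upwards [Ioo_mem_nhdsGT hdj] with r hr
      refine le_trans ?_ (hx.2 r (diam_nonneg.trans_lt hr.1) hr.2)
      simp only [ENNReal.coe_natCast]
      gcongr
      · intro y hy
        exact mem_closedBall.2 ((dist_le_diam_of_mem' hfin hy hxs).trans hr.1.le)
      · exact fun y hy => hZE hy.1
    have hlim : Tendsto (fun r : ℝ => ENNReal.ofReal r ^ α) (𝓝[>] (diam s))
        (𝓝 (ENNReal.ofReal (diam s) ^ α)) :=
      ((ENNReal.continuous_rpow_const.comp ENNReal.continuous_ofReal).tendsto _).mono_left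
        nhdsWithin_le_nhds
    have := ge_of_tendsto hlim key
    rwa [diam, ENNReal.ofReal_toReal hfin] at this
  have hle (c : ℕ) (A : Set X) (hA : MeasurableSet A) : c * ν (A ∩ Z) ≤ μH[α] A := by
    have h1 : ν (A ∩ Z) ≤ ⨆ j, ν (A ∩ S c j) := by
      rw [← Monotone.measure_iUnion fun i j hij => inter_subset_inter_right A (hSmono c hij),
        ← inter_iUnion]
      exact measure_mono (inter_subset_inter_right A (hSU c))
    calc c * ν (A ∩ Z) ≤ c * ⨆ j, ν (A ∩ S c j) := by gcongr
      _ = ⨆ j, c * ν (A ∩ S c j) := ENNReal.mul_iSup _ _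
      _ ≤ μH[α] A := iSup_le fun j => by
        have := hS c j A
        rw [Measure.smul_apply, Measure.restrict_apply hA] at this
        simpa [ENNReal.smul_def] using this
  refine measure_null_of_locally_null Z fun x hx => ?_
  obtain ⟨r, hr, hfr⟩ := hfin x hx
  refine ⟨closedBall x r ∩ Z, inter_mem (mem_nhdsWithin_of_mem_nhds (closedBall_mem_nhds x hr))
    self_mem_nhdsWithin, ?_⟩
  by_contra hne
  obtain ⟨c, hc⟩ := ENNReal.exists_nat_mul_gt hne hfr
  exact hc.not_ge (hle c _ isClosed_closedBall.measurableSet)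

/-- If on balls centred in `E` the Hausdorff measure is at most `a • ν`, while `b • ν` is at most
`(diam U)^α` on traces `U ∩ E` of small sets, with `a < b`, then `E` is `ν`-null. -/
theorem measure_eq_zero_of_hausdorffMeasure_closedBall_le [SecondCountableTopology X] {α : ℝ}
    (hα : 0 < α) {ν : Measure X} [IsFiniteMeasure ν] {E : Set X} {a b : ℝ≥0} (hab : a < b) {ε : ℝ}
    (hε : 0 < ε)
    (hball : ∀ x ∈ E, ∀ r, 0 < r → r < ε → μH[α] (closedBall x r) ≤ a * ν (closedBall x r))
    (hdiam : ∀ U : Set X, ediam U ≤ ENNReal.ofReal ε → b * ν (U ∩ E) ≤ ediam U ^ α) :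
    ν E = 0 := by
  have hb : b ≠ 0 := (hab.trans_le' zero_le).ne'
  have hle : b • ν.restrict E ≤ μH[α] :=
    smul_restrict_le_hausdorffMeasure (by simpa using hε) hdiam
  -- Points of positive upper density, quantified by `c`; the rest of `E` has density zero.
  let D : ℕ → Set X := fun c =>
    {x ∈ E | ∃ᶠ r in 𝓝[>] (0 : ℝ), ENNReal.ofReal r ^ α ≤ c * ν (closedBall x r ∩ E)}
  have hrest : ν (E \ ⋃ c, D c) = 0 := by
    refine measure_eq_zero_of_density_eq_zero (α := α) (E := E) sdiff_subset (fun x hx c => ?_)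
      fun x hx => ⟨ε / 2, by positivity, ?_⟩
    · have : x ∉ D c := fun h => hx.2 (mem_iUnion.2 ⟨c, h⟩)
      have h2 : ¬ ∃ᶠ r in 𝓝[>] (0 : ℝ), ENNReal.ofReal r ^ α ≤ c * ν (closedBall x r ∩ E) :=
        fun h => this ⟨hx.1, h⟩
      filter_upwards [not_frequently.1 h2] with r hr using (not_le.1 hr).le
    · exact ne_top_of_le_ne_top (by finiteness) (hball x hx.1 (ε / 2) (by positivity) (by linarith))
  have hopen (c : ℕ) (U : Set X) (hU : IsOpen U) (hDU : D c ⊆ U) : b * ν (D c) ≤ a * ν U := by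
    -- Radii below `ε / 6` keep the diameter of the tripled ball below `ε`, so `hdiam` applies to
    -- it.
    let t : Set (X × ℝ) := {p | p.1 ∈ D c ∧ 0 < p.2 ∧ p.2 < ε / 6 ∧ closedBall p.1 p.2 ⊆ U ∧
      ENNReal.ofReal p.2 ^ α ≤ c * ν (closedBall p.1 p.2 ∩ E)}
    have hdoubling : ∀ p ∈ t, ν.restrict E (closedBall p.1 (3 * p.2)) ≤
        ((6 : ℝ≥0) ^ α * c / b : ℝ≥0) * ν.restrict E (closedBall p.1 p.2) := by
      intro p hp
      obtain ⟨hpD, hp0, hpε, -, hpc⟩ := hp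
      have hd : ediam (closedBall p.1 (3 * p.2)) ≤ ENNReal.ofReal (6 * p.2) := by
        rw [← Metric.closedEBall_ofReal (by positivity)]
        refine ediam_closedEBall_le.trans ?_
        rw [show 6 * p.2 = 2 * (3 * p.2) by ring, ENNReal.ofReal_mul zero_le_two]
        simp
      have h1 := hdiam (closedBall p.1 (3 * p.2)) (hd.trans (by gcongr; linarith))
      rw [Measure.restrict_apply isClosed_closedBall.measurableSet,
        Measure.restrict_apply isClosed_closedBall.measurableSet]
      have h2 : b * ν (closedBall p.1 (3 * p.2) ∩ E) ≤
          6 ^ α * c * ν (closedBall p.1 p.2 ∩ E) := by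
        calc _ ≤ _ := h1
          _ ≤ ENNReal.ofReal (6 * p.2) ^ α := by gcongr
          _ = 6 ^ α * ENNReal.ofReal p.2 ^ α := by
            rw [ENNReal.ofReal_mul (by norm_num), ENNReal.mul_rpow_of_nonneg _ _ hα.le]; simp
          _ ≤ 6 ^ α * (c * ν (closedBall p.1 p.2 ∩ E)) := by gcongr
          _ = _ := by ring
      rw [ENNReal.coe_div hb, ENNReal.coe_mul, ENNReal.coe_rpow_of_nonneg _ hα.le]
      rw [ENNReal.mul_comm_div, ← mul_div_assoc, ENNReal.le_div_iff_mul_le (by simp [hb]) (by simp),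
        mul_comm]
      simpa using h2
    have hfine : ∀ x ∈ D c, ∀ δ > (0 : ℝ), ∃ p ∈ t, p.2 ≤ δ ∧ p.1 = x := by
      intro x hx δ hδ
      obtain ⟨η, hη, hηU⟩ := nhds_basis_closedBall.mem_iff.1 (hU.mem_nhds (hDU hx))
      have hmin : 0 < min (min η δ) (ε / 6) := by positivity
      obtain ⟨r, hr, hr'⟩ := (hx.2.and_eventually (Ioo_mem_nhdsGT hmin)).exists
      simp only [lt_min_iff] at hr'
      exact ⟨(x, r), ⟨hx, hr'.1, hr'.2.2, (closedBall_subset_closedBall hr'.2.1.1.le).trans hηU,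
        hr⟩, hr'.2.1.2.le, rfl⟩
    obtain ⟨u, hut, huc, hud, hu0⟩ := Vitali.exists_disjoint_covering_ae (ν.restrict E) (D c) t
      ((6 : ℝ≥0) ^ α * c / b) Prod.snd Prod.fst (fun p => closedBall p.1 p.2)
      (fun p _ => Subset.rfl) hdoubling
      (fun p hp => ⟨p.1, ball_subset_interior_closedBall (mem_ball_self hp.2.1)⟩)
      (fun p _ => isClosed_closedBall) hfine
    have hm : MeasurableSet (⋃ p ∈ u, closedBall p.1 p.2) :=
      MeasurableSet.biUnion huc fun p _ => isClosed_closedBall.measurableSet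
    have h0 : ν (D c \ ⋃ p ∈ u, closedBall p.1 p.2) = 0 := by
      rw [← nonpos_iff_eq_zero, ← hu0]
      refine le_trans (measure_mono ?_) (Measure.le_restrict_apply _ _)
      exact fun x hx => ⟨hx, hx.1.1⟩
    have h1 : ν (D c) ≤ ν ((⋃ p ∈ u, closedBall p.1 p.2) ∩ E) := by
      calc ν (D c) ≤ ν (((⋃ p ∈ u, closedBall p.1 p.2) ∩ E) ∪
            (D c \ ⋃ p ∈ u, closedBall p.1 p.2)) := by
            refine measure_mono fun x hx => ?_
            by_cases h : x ∈ ⋃ p ∈ u, closedBall p.1 p.2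
            exacts [Or.inl ⟨h, hx.1⟩, Or.inr ⟨hx, h⟩]
        _ ≤ _ := (measure_union_le _ _).trans_eq (by rw [h0, add_zero])
    have h2 : b * ν ((⋃ p ∈ u, closedBall p.1 p.2) ∩ E) ≤ μH[α] (⋃ p ∈ u, closedBall p.1 p.2) := by
      have := hle (⋃ p ∈ u, closedBall p.1 p.2)
      rwa [Measure.smul_apply, Measure.restrict_apply hm] at this
    calc b * ν (D c) ≤ b * ν ((⋃ p ∈ u, closedBall p.1 p.2) ∩ E) := by gcongr
      _ ≤ μH[α] (⋃ p ∈ u, closedBall p.1 p.2) := h2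
      _ ≤ ∑' p : u, μH[α] (closedBall p.1.1 p.1.2) := measure_biUnion_le _ huc _
      _ ≤ ∑' p : u, a * ν (closedBall p.1.1 p.1.2) := ENNReal.tsum_le_tsum fun p => by
        have hp := hut p.2
        exact hball _ hp.1.1 _ hp.2.1 (by linarith [hp.2.2.1])
      _ = a * ν (⋃ p ∈ u, closedBall p.1 p.2) := by
        rw [ENNReal.tsum_mul_left,
          measure_biUnion huc hud fun p _ => isClosed_closedBall.measurableSet]
      _ ≤ a * ν U := by
        gcongr
        exact iUnion₂_subset fun p hp => (hut hp).2.2.2.1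
  have hD (c : ℕ) : ν (D c) = 0 := by
    by_contra hne
    have hlt : a * ν (D c) < b * ν (D c) :=
      ENNReal.mul_lt_mul_left hne (measure_ne_top _ _) (ENNReal.coe_lt_coe.2 hab)
    -- Outer regularity is used at level `b * ν (D c) / a`, hence the separate case `a = 0`.
    rcases eq_or_ne a 0 with rfl | ha
    · have := hopen c univ isOpen_univ (subset_univ _)
      simp [hb, hne] at this
    · have ha' : (a : ℝ≥0∞) ≠ 0 := by simpa using ha
      obtain ⟨U, hDU, hU, hνU⟩ := (D c).exists_isOpen_lt_of_lt (b * ν (D c) / a)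
        ((ENNReal.lt_div_iff_mul_lt (by simp [ha]) (by simp)).2 (by rwa [mul_comm]))
      rw [ENNReal.lt_div_iff_mul_lt (by simp [ha]) (by simp), mul_comm] at hνU
      exact hνU.not_ge (hopen c U hU hDU)
  refine measure_mono_null (t := (E \ ⋃ c, D c) ∪ ⋃ c, D c) (by simp) ?_
  exact measure_union_null hrest (measure_iUnion_null hD)

end Hausdorff

/-! ### Return times and the recurrence bound. -/

section Recurrence

variable {X : Type*}

/-- If `F` does not return to itself before time `K`, then `μ F ≤ 1 / K`. -/
theorem natCast_mul_measure_le_one_of_no_return [MeasurableSpace X] {μ : Measure X}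
    [IsProbabilityMeasure μ] {T : X → X} (hT : MeasurePreserving T μ μ) {F : Set X}
    (hF : MeasurableSet F) {K : ℕ} (h : ∀ n, 1 ≤ n → n < K → ∀ x ∈ F, T^[n] x ∉ F) :
    K * μ F ≤ 1 := by
  have hlt : ∀ i j, i < j → j < K → Disjoint (T^[i] ⁻¹' F) (T^[j] ⁻¹' F) := by
    refine fun i j hij hj => Set.disjoint_left.2 fun x hxi hxj => ?_
    refine h (j - i) (by omega) (by omega) _ hxi ?_
    rwa [← Function.iterate_add_apply, Nat.sub_add_cancel hij.le]
  have hd : Set.PairwiseDisjoint (Finset.range K : Set ℕ) fun i => T^[i] ⁻¹' F := by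
    intro i hi j hj hij
    rw [Finset.coe_range, mem_Iio] at hi hj
    rcases hij.lt_or_gt with hl | hl
    exacts [hlt i j hl hj, (hlt j i hl hi).symm]
  calc K * μ F = ∑ i ∈ Finset.range K, μ (T^[i] ⁻¹' F) := by
        simp [(hT.iterate _).measure_preimage hF.nullMeasurableSet]
    _ = μ (⋃ i ∈ Finset.range K, T^[i] ⁻¹' F) :=
        (measure_biUnion_finset hd fun i _ => (hT.iterate i).measurable hF).symm
    _ ≤ 1 := prob_le_one

/-- If every return to `F` at time `n` satisfies `q < n^{1/α} d(T^n x, x)`, then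
`q^α μ(F) ≤ (diam F)^α`. -/
theorem rpow_mul_measure_le_ediam_rpow [MetricSpace X] [MeasurableSpace X] {μ : Measure X}
    [IsProbabilityMeasure μ] {T : X → X} (hT : MeasurePreserving T μ μ) {α : ℝ} (hα : 0 < α)
    {q : ℝ≥0} {F : Set X} (hF : MeasurableSet F) (hd : ediam F ≠ ∞)
    (h : ∀ x ∈ F, ∀ n : ℕ, 1 ≤ n → T^[n] x ∈ F → (q : ℝ) < (n : ℝ) ^ (1 / α) * dist (T^[n] x) x) :
    ((q ^ α : ℝ≥0) : ℝ≥0∞) * μ F ≤ ediam F ^ α := by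
  have hq : (0 : ℝ) ≤ q := q.2
  have hR0 : (0 : ℝ) ≤ diam F ^ α := Real.rpow_nonneg diam_nonneg _
  have hret : ∀ x ∈ F, ∀ n : ℕ, 1 ≤ n → T^[n] x ∈ F → (q : ℝ) ^ α < n * diam F ^ α := by
    intro x hx n hn hxn
    have h1 : (q : ℝ) < (n : ℝ) ^ (1 / α) * diam F :=
      (h x hx n hn hxn).trans_le (by gcongr; exact dist_le_diam_of_mem' hd hxn hx)
    have h2 := Real.rpow_lt_rpow hq h1 hα
    rwa [Real.mul_rpow (by positivity) diam_nonneg, ← Real.rpow_mul (by positivity),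
      one_div_mul_cancel hα.ne', Real.rpow_one] at h2
  have hK (K : ℕ) (hK : ∀ n : ℕ, n < K → n * diam F ^ α ≤ (q : ℝ) ^ α) : K * μ.real F ≤ 1 := by
    have := natCast_mul_measure_le_one_of_no_return hT hF (K := K) fun n h1 h2 x hx hxn =>
      (hret x hx n h1 hxn).not_ge (hK n h2)
    simpa [Measure.real] using ENNReal.toReal_mono ENNReal.one_ne_top this
  have key : (q : ℝ) ^ α * μ.real F ≤ diam F ^ α := by
    -- With zero diameter no return ever occurs, so `K` is arbitrary and `F` is null.
    rcases hR0.eq_or_lt with hR | hR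
    · have hF0 : μ.real F = 0 := by
        by_contra hne
        obtain ⟨K, hK'⟩ := Archimedean.arch (2 : ℝ)
          (measureReal_nonneg.lt_of_ne' hne : 0 < μ.real F)
        have := hK K fun n _ => by rw [← hR, mul_zero]; positivity
        rw [nsmul_eq_mul] at hK'
        linarith
      rw [hF0, mul_zero]
      exact hR0
    · have h1 := hK ⌈(q : ℝ) ^ α / diam F ^ α⌉₊ fun n hn =>
        ((lt_div_iff₀ hR).1 (Nat.lt_ceil.1 hn)).le
      have h2 : (q : ℝ) ^ α / diam F ^ α * μ.real F ≤ 1 :=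
        (mul_le_mul_of_nonneg_right (Nat.le_ceil _) measureReal_nonneg).trans h1
      rwa [div_mul_eq_mul_div, div_le_one hR] at h2
  have h3 := ENNReal.ofReal_le_ofReal key
  rwa [ENNReal.ofReal_mul (by positivity), ofReal_measureReal,
    ← ENNReal.ofReal_rpow_of_nonneg hq hα.le, ← ENNReal.ofReal_rpow_of_nonneg diam_nonneg hα.le, diam,
    ENNReal.ofReal_toReal hd, ENNReal.ofReal_coe_nnreal, ← ENNReal.coe_rpow_of_nonneg _ hα.le] at h3

/-- A strict lower bound on `recurrenceLiminf` gives a lower bound along all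
close returns. -/
theorem exists_forall_dist_lt_of_lt_recurrenceLiminf [MetricSpace X] {T : X → X} {α : ℝ}
    {x : X} {q : ℝ≥0}
    (h : (q : ℝ≥0∞) < recurrenceLiminf T α x) :
    ∃ η > 0, ∀ n : ℕ, 1 ≤ n → dist (T^[n] x) x < η →
      (q : ℝ) < (n : ℝ) ^ (1 / α) * dist (T^[n] x) x := by
  have hev : ∀ᶠ n : ℕ in atTop, (q : ℝ) < (n : ℝ) ^ (1 / α) * dist (T^[n] x) x := by
    filter_upwards [eventually_lt_of_lt_liminf h] with n hn
    rw [← ENNReal.ofReal_coe_nnreal] at hn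
    exact (ENNReal.ofReal_lt_ofReal_iff_of_nonneg q.2).1 hn
  obtain ⟨N, hN⟩ := eventually_atTop.1 hev
  -- A periodic point would return exactly at some multiple of its period beyond `N`.
  have hpos : ∀ n : ℕ, 1 ≤ n → 0 < dist (T^[n] x) x := by
    refine fun n hn => dist_pos.2 fun hper => ?_
    have hfix : T^[n * (N + 1)] x = x := (Function.IsPeriodicPt.mul_const (f := T) hper (N + 1))
    have := hN (n * (N + 1)) (by nlinarith)
    rw [hfix, dist_self, mul_zero] at this
    exact this.not_ge q.2
  have hmin : ∀ᶠ η in 𝓝[>] (0 : ℝ), ∀ n ∈ Finset.Ico 1 N, η < dist (T^[n] x) x :=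
    (Finset.eventually_all _).2 fun n hn =>
      (eventually_lt_nhds (hpos n (Finset.mem_Ico.1 hn).1)).filter_mono nhdsWithin_le_nhds
  obtain ⟨η, hη, hη0⟩ := (hmin.and self_mem_nhdsWithin).exists
  refine ⟨η, hη0, fun n hn hd => hN n ?_⟩
  by_contra hlt
  exact (hη n (Finset.mem_Ico.2 ⟨hn, not_le.1 hlt⟩)).not_gt hd

variable [MetricSpace X] [MeasurableSpace X] [BorelSpace X]

/-- On a separable set `W`, returns to `W` at a prescribed distance form a measurable set. -/
theorem measurableSet_dist_mem {W : Set X} [SecondCountableTopology W] (hW : MeasurableSet W)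
    {f : X → X} (hf : Measurable f) {S : Set ℝ} (hS : MeasurableSet S) :
    MeasurableSet {x ∈ W | f x ∈ W → dist (f x) x ∈ S} := by
  let V : Set X := W ∩ f ⁻¹' W
  have hV : MeasurableSet V := hW.inter (hf hW)
  have h1 : Measurable fun x : V => (⟨x, x.2.1⟩ : W) := measurable_subtype_coe.subtype_mk
  have h2 : Measurable fun x : V => (⟨f x, x.2.2⟩ : W) :=
    (hf.comp measurable_subtype_coe).subtype_mk
  have h3 : MeasurableSet (Subtype.val '' {x : V | dist (f x) (x : X) ∈ Sᶜ}) :=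
    hV.subtype_image ((h2.dist h1) hS.compl)
  convert hW.diff h3 using 1
  ext x
  simp [V]
  tauto

/-- A comparison on open balls passes to closed balls. -/
theorem hausdorffMeasure_closedBall_le {μ : Measure X} [IsFiniteMeasure μ] {α : ℝ} {a : ℝ≥0}
    {x : X} {ε : ℝ}
    (h : ∀ r, 0 < r → r < ε → μH[α] (ball x r) ≤ a * μ (ball x r)) {r : ℝ} (hr : 0 < r)
    (hrε : r < ε) : μH[α] (closedBall x r) ≤ a * μ (closedBall x r) := by
  have hI : ⋂ s > r, ball x s = closedBall x r := by
    ext y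
    simp only [mem_iInter, mem_ball, mem_closedBall]
    exact ⟨fun h => le_of_forall_gt h, fun h s hs => h.trans_lt hs⟩
  have ht : Tendsto (fun s => μ (ball x s)) (𝓝[>] r) (𝓝 (μ (closedBall x r))) := by
    rw [← hI]
    exact tendsto_measure_biInter_gt (fun s _ => isOpen_ball.measurableSet.nullMeasurableSet)
      (fun i j _ hij => ball_subset_ball hij) ⟨r + 1, by simp, by finiteness⟩
  refine ge_of_tendsto (ENNReal.Tendsto.const_mul ht (Or.inr ENNReal.coe_ne_top)) ?_
  filter_upwards [Ioo_mem_nhdsGT hrε] with s hs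
  exact (measure_mono (closedBall_subset_ball hs.1)).trans (h s (hr.trans hs.1) hs.2)

/-- A set whose points carry balls of positive mass and finite Hausdorff measure at a uniform scale
has a separable uniform neighbourhood. -/
theorem isSeparable_biUnion_ball {μ : Measure X} [IsFiniteMeasure μ] {α : ℝ} {E : Set X}
    {ρ : ℝ} (hpos : ∀ x ∈ E, 0 < μ (ball x ρ))
    (hfin : ∀ x ∈ E, μH[α] (closedBall x (5 * ρ)) ≠ ∞) :
    TopologicalSpace.IsSeparable (⋃ x ∈ E, ball x ρ) := by
  obtain ⟨u, huE, hud, hu⟩ := Vitali.exists_disjoint_subfamily_covering_enlargement_closedBall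
    E id (fun _ => ρ) ρ (fun _ _ => le_rfl) 5 (by norm_num)
  have huc : u.Countable := by
    have := Measure.countable_meas_pos_of_disjoint_iUnion (μ := μ)
      (As := fun x : u => closedBall (x : X) ρ) (fun _ => isClosed_closedBall.measurableSet)
      (fun x y hxy => hud x.2 y.2 (Subtype.coe_injective.ne hxy))
    have huniv : {x : u | 0 < μ (closedBall (x : X) ρ)} = univ :=
      eq_univ_of_forall fun x => (hpos x (huE x.2)).trans_le (measure_mono ball_subset_closedBall)
    rw [huniv, countable_univ_iff] at this
    exact this
  have hsep : TopologicalSpace.IsSeparable (⋃ y ∈ u, closedBall y (5 * ρ)) := by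
    have := huc.to_subtype
    rw [biUnion_eq_iUnion]
    exact .iUnion fun y => isSeparable_of_hausdorffMeasure_ne_top (hfin y (huE y.2))
  refine hsep.mono (iUnion₂_subset fun x hx => ?_)
  obtain ⟨y, hy, hxy⟩ := hu x hx
  exact (ball_subset_closedBall.trans hxy).trans (subset_biUnion_of_mem (u := fun y =>
    closedBall y (5 * ρ)) hy)

/-- Points with a uniform lower bound `q` on close returns and a uniform upper bound `a < q ^ α` on
the ratio of Hausdorff measure to mass of small balls form a null set. -/
theorem measure_eq_zero_of_recurrence_lower_bound {μ : Measure X} [IsProbabilityMeasure μ]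
    {T : X → X} (hT : MeasurePreserving T μ μ) {α : ℝ} (hα : 0 < α) {a q : ℝ≥0} (haq : a < q ^ α)
    {E : Set X} {ε : ℝ} (hε : 0 < ε) (hpos : ∀ x ∈ E, ∀ r, 0 < r → 0 < μ (ball x r))
    (hball : ∀ x ∈ E, ∀ r, 0 < r → r < ε → μH[α] (ball x r) ≤ a * μ (ball x r))
    (hrec : ∀ x ∈ E, ∀ n : ℕ, 1 ≤ n → dist (T^[n] x) x < ε →
      (q : ℝ) < (n : ℝ) ^ (1 / α) * dist (T^[n] x) x) :
    μ E = 0 := by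
  have hcball : ∀ x ∈ E, ∀ r, 0 < r → r < ε → μH[α] (closedBall x r) ≤ a * μ (closedBall x r) :=
    fun x hx r hr hrε => hausdorffMeasure_closedBall_le (hball x hx) hr hrε
  -- The factor `5` is the Vitali enlargement in `isSeparable_biUnion_ball`.
  obtain ⟨ρ, hρ, hρε⟩ : ∃ ρ : ℝ, 0 < ρ ∧ 5 * ρ < ε := ⟨ε / 6, by positivity, by linarith⟩
  let W : Set X := ⋃ x ∈ E, ball x ρ
  have hWo : IsOpen W := isOpen_biUnion fun _ _ => isOpen_ball
  have hWm : MeasurableSet W := hWo.measurableSet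
  have hEW : E ⊆ W := fun x hx => mem_biUnion hx (mem_ball_self hρ)
  have hsep : TopologicalSpace.IsSeparable W :=
    isSeparable_biUnion_ball (μ := μ) (α := α) (fun x hx => hpos x hx ρ hρ) fun x hx =>
      ne_top_of_le_ne_top (by finiteness) (hcball x hx _ (by positivity) hρε)
  have : SecondCountableTopology W :=
    have := hsep.separableSpace
    UniformSpace.secondCountable_of_separable W
  -- A measurable superset of the possibly non-measurable `E` that keeps the return bound for
  -- returns to `W`.
  let G : Set X := W ∩ ⋂ n : ℕ, ⋂ _ : 1 ≤ n, {x ∈ W | T^[n] x ∈ W → dist (T^[n] x) x ∈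
    {d : ℝ | d < ε → (q : ℝ) < (n : ℝ) ^ (1 / α) * d}}
  have hG : MeasurableSet G := by
    refine hWm.inter (.iInter fun n => .iInter fun _ =>
      measurableSet_dist_mem hWm (hT.iterate n).measurable ?_)
    exact (measurableSet_lt measurable_id measurable_const).imp
      (measurableSet_lt measurable_const (measurable_id.const_mul _))
  have hEG : E ⊆ G := fun x hx =>
    ⟨hEW hx, mem_iInter₂.2 fun n hn => ⟨hEW hx, fun _ => hrec x hx n hn⟩⟩
  have hcomap := comap_subtype_coe_apply hWm μ
  have hzero : (μ.comap ((↑) : W → X)) ((↑) ⁻¹' E) = 0 := by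
    refine measure_eq_zero_of_hausdorffMeasure_closedBall_le hα haq hρ (fun x hx r hr hrρ => ?_)
      fun U hU => ?_
    -- Balls of radius below `ρ` centred in `E` lie in `W`, so passing to the subtype loses nothing.
    · have himg : ((↑) : W → X) '' closedBall x r = closedBall (x : X) r := by
        refine Subset.antisymm (image_subset_iff.2 fun y hy => hy) fun y hy => ?_
        exact ⟨⟨y, mem_biUnion hx (closedBall_subset_ball hrρ hy)⟩, hy, rfl⟩
      rw [hcomap, ← isometry_subtype_coe.hausdorffMeasure_image (Or.inl hα.le), himg]
      exact hcball x hx r hr (by linarith)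
    · have hdU : ediam (closure (((↑) : W → X) '' U)) = ediam U := by
        rw [ediam_closure, isometry_subtype_coe.ediam_image]
      have hdF : ediam (closure (((↑) : W → X) '' U) ∩ G) ≤ ediam U :=
        (ediam_mono inter_subset_left).trans hdU.le
      have hdF' := hdF.trans hU
      calc ((q ^ α : ℝ≥0) : ℝ≥0∞) * μ.comap ((↑) : W → X) (U ∩ (↑) ⁻¹' E)
          ≤ ((q ^ α : ℝ≥0) : ℝ≥0∞) * μ (closure (((↑) : W → X) '' U) ∩ G) := by
            rw [hcomap]
            gcongr
            rintro _ ⟨y, ⟨hyU, hyE⟩, rfl⟩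
            exact ⟨subset_closure (mem_image_of_mem _ hyU), hEG hyE⟩
        _ ≤ ediam (closure (((↑) : W → X) '' U) ∩ G) ^ α := by
            refine rpow_mul_measure_le_ediam_rpow hT hα (isClosed_closure.measurableSet.inter hG)
              (ne_top_of_le_ne_top ENNReal.ofReal_ne_top hdF') fun x hx n hn hxn => ?_
            refine (mem_iInter₂.1 hx.2.2 n hn).2 hxn.2.1 ?_
            have h1 := dist_le_diam_of_mem' (ne_top_of_le_ne_top ENNReal.ofReal_ne_top hdF') hxn hx
            have h2 := ENNReal.toReal_le_of_le_ofReal hρ.le hdF'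
            exact (h1.trans h2).trans_lt (by linarith)
        _ ≤ ediam U ^ α := by gcongr
  rwa [hcomap, Subtype.image_preimage_coe, inter_eq_right.2 hEW] at hzero

/-- An upper bound on `hausdorffRatio` bounds the Hausdorff measure of small balls. -/
theorem exists_forall_hausdorffMeasure_ball_le {μ : Measure X} [IsFiniteMeasure μ] {α : ℝ} {x : X}
    (hpos : ∀ r, 0 < r → 0 < μ (ball x r)) {a : ℝ≥0} (h : hausdorffRatio μ α x < a) :
    ∃ ε > 0, ∀ r, 0 < r → r < ε → μH[α] (ball x r) ≤ a * μ (ball x r) := by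
  obtain ⟨ε, hε, hr⟩ := (nhdsGT_basis (0 : ℝ)).eventually_iff.1 (eventually_lt_of_limsup_lt h)
  exact ⟨ε, hε, fun r h0 h1 =>
    (ENNReal.div_le_iff (hpos r h0).ne' (measure_ne_top _ _)).1 (hr ⟨h0, h1⟩).le⟩

/-- The recurrence bound for measure-preserving maps; ergodicity is not needed. -/
theorem ae_recurrenceLiminf_le {μ : Measure X} [IsProbabilityMeasure μ] {T : X → X}
    (hT : MeasurePreserving T μ μ) {α : ℝ} (hα : 0 < α) :
    ∀ᵐ x ∂μ, (∀ r : ℝ, 0 < r → 0 < μ (ball x r)) →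
      recurrenceLiminf T α x ≤ hausdorffRatio μ α x ^ (1 / α) := by
  -- Rational thresholds and scales `1 / (k + 1)` make the exceptional set a countable union.
  let E : ℚ → ℚ → ℕ → Set X := fun p q k =>
    {x | (∀ r, 0 < r → 0 < μ (ball x r)) ∧
      (∀ r, 0 < r → r < 1 / ((k : ℝ) + 1) →
        μH[α] (ball x r) ≤ ((Real.toNNReal p) ^ α : ℝ≥0) * μ (ball x r)) ∧
      ∀ n : ℕ, 1 ≤ n → dist (T^[n] x) x < 1 / ((k : ℝ) + 1) →
        ((Real.toNNReal q : ℝ≥0) : ℝ) < (n : ℝ) ^ (1 / α) * dist (T^[n] x) x}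
  have hE (p q : ℚ) (k : ℕ) (hpq : Real.toNNReal p < Real.toNNReal q) : μ (E p q k) = 0 :=
    measure_eq_zero_of_recurrence_lower_bound hT hα (NNReal.rpow_lt_rpow hpq hα)
      (by positivity) (fun x hx => hx.1) (fun x hx => hx.2.1) fun x hx => hx.2.2
  have hae : ∀ᵐ x ∂μ, ∀ (p q : ℚ) (k : ℕ), Real.toNNReal p < Real.toNNReal q → x ∉ E p q k := by
    simp only [ae_all_iff]
    exact fun p q k hpq => measure_eq_zero_iff_ae_notMem.1 (hE p q k hpq)
  filter_upwards [hae] with x hx hpos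
  by_contra hlt
  obtain ⟨p, -, hgp, hp⟩ := ENNReal.lt_iff_exists_rat_btwn.1 (not_le.1 hlt)
  obtain ⟨q, -, hpq, hq⟩ := ENNReal.lt_iff_exists_rat_btwn.1 hp
  have hgp' : hausdorffRatio μ α x < ((Real.toNNReal p) ^ α : ℝ≥0) := by
    rw [ENNReal.coe_rpow_of_nonneg _ hα.le]
    simpa [← ENNReal.rpow_mul, hα.ne'] using ENNReal.rpow_lt_rpow hgp hα
  obtain ⟨ε, hε, hb⟩ := exists_forall_hausdorffMeasure_ball_le hpos hgp'
  obtain ⟨η, hη, hr⟩ := exists_forall_dist_lt_of_lt_recurrenceLiminf hq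
  obtain ⟨k, hk⟩ := exists_nat_one_div_lt (lt_min hε hη)
  rw [lt_min_iff] at hk
  exact hx p q k (ENNReal.coe_lt_coe.1 hpq) ⟨hpos, fun r h0 h1 => hb r h0 (h1.trans hk.1),
    fun n hn hd => hr n hn (hd.trans hk.2)⟩

end Recurrence

end

theorem theorem1 {X : Type*} [MetricSpace X] [MeasurableSpace X] [BorelSpace X]
    (μ : Measure X) [IsProbabilityMeasure μ] (T : X → X) (hT : Ergodic T μ)
    (α : ℝ) (hα : 0 < α) :
    (∀ᵐ x ∂μ, (∀ r : ℝ, 0 < r → 0 < μ (Metric.ball x r)) →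
      recurrenceLiminf T α x ≤ hausdorffRatio μ α x ^ (1 / α)) ∧
    (TopologicalSpace.SeparableSpace X →
      ∀ᵐ x ∂μ, recurrenceLiminf T α x ≤ hausdorffRatio μ α x ^ (1 / α)) := by
  have h := ae_recurrenceLiminf_le hT.toMeasurePreserving hα
  refine ⟨h, fun _ => ?_⟩
  have : SecondCountableTopology X := UniformSpace.secondCountable_of_separable X
  filter_upwards [h, Measure.support_mem_ae] with x hx hsupp
  exact hx fun r hr => (Measure.mem_support_iff_forall x).1 hsupp _ (Metric.ball_mem_nhds x hr)
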